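/- Throughout, a \emph{hyperbolic space} is a geodesic metric space $(S,d)$ (not necessarily proper) such that, for some $\delta\ge 0$, each side of every geodesic triangle in $S$ lies in the $\delta$-neighbourhood of the union of the other two sides. Its Gromov boundary $\partial S$ is the set of sequences $(x_i)$ in $S$ with $(x_i,x_j)_s\to\infty$ as $i,j\to\infty$, modulo the relation $(x_i)\sim(y_i)$ iff $(x_i,y_j)_s\to\infty$ as $i,j\to\infty$, where $(x,y)_s=\frac12\big(d(x,s)+d(y,s)-d(x,y)\big)$; these notions do not depend on $s\in S$. For a group $G$ acting on $S$ by isometries, the limit set $\Lambda(G)\subseteq\partial S$ is the set of limits in $\partial S$ of sequences of points of an orbit $Gs$ (it does not depend on $s$). The action is \emph{non-elementary} if $\Lambda(G)$ is infinite, and \emph{acylindrical} if for every $\varepsilon>0$ there exist $R,N>0$ such that for all $x,y\in S$ with $d(x,y)\ge R$ there are at most $N$ elements $g\in G$ with $d(x,gx)\le\varepsilon$ and $d(y,gy)\le\varepsilon$. A group is \emph{acylindrically hyperbolic} if it admits a non-elementary acylindrical isometric action on a hyperbolic space. Every acylindrically hyperbolic group $G$ has a unique maximal finite normal subgroup, denoted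 $K(G)$. Let $G$ be a countable acylindrically hyperbolic group acting ergodically by measure-preserving Borel transformations on a standard Borel probability space $(X,\nu)$. Then either the stabilizer $G_x=\{g\in G : gx=x\}$ is acylindrically hyperbolic for $\nu$-a.e. $x\in X$, or $G_x$ is finite for $\nu$-a.e. $x\in X$. If, in addition, $K(G)=1$, then in the latter case the action is essentially free, i.e. $G_x=1$ for $\nu$-a.e. $x\in X$. -/

import Mathlib

open Set Filter MeasureTheory

universe u v w

noncomputable section

namespace AcylHyp

section HyperbolicSpaces

variable {S : Type w} [MetricSpace S]

/-- `γ`, restricted to `[0, dist x y]`, is a geodesic from `x` to `y`. -/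
structure IsGeodesic (γ : ℝ → S) (x y : S) : Prop where
  source : γ 0 = x
  target : γ (dist x y) = y
  isom : ∀ s ∈ Icc (0 : ℝ) (dist x y), ∀ t ∈ Icc (0 : ℝ) (dist x y),
    dist (γ s) (γ t) = |s - t|

/-- Every side of every geodesic triangle lies in the closed `δ`-neighbourhood of the union of
the other two sides. (The vertices are arbitrary, so it suffices to name one side.) -/
def SlimTriangles (S : Type w) [MetricSpace S] (δ : ℝ) : Prop :=
  ∀ (x y z : S) (α β γ : ℝ → S), IsGeodesic α x y → IsGeodesic β y z → IsGeodesic γ x z →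
    ∀ s ∈ Icc (0 : ℝ) (dist x y),
      (∃ t ∈ Icc (0 : ℝ) (dist y z), dist (α s) (β t) ≤ δ) ∨
      (∃ t ∈ Icc (0 : ℝ) (dist x z), dist (α s) (γ t) ≤ δ)

/-- A hyperbolic space: a geodesic metric space, not necessarily proper, all of whose geodesic
triangles are `δ`-slim for some `δ ≥ 0`. -/
def IsHyperbolicSpace (S : Type w) [MetricSpace S] : Prop :=
  (∀ x y : S, ∃ γ : ℝ → S, IsGeodesic γ x y) ∧ ∃ δ : ℝ, 0 ≤ δ ∧ SlimTriangles S δ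

/-- The Gromov product `(x, y)_z`. -/
def gromovProduct (x y z : S) : ℝ :=
  (dist x z + dist y z - dist x y) / 2

/-- `(x_i, y_j)_s → ∞` as `i, j → ∞`. This does not depend on the base point `s`. -/
def SeqEquivalent (x y : ℕ → S) : Prop :=
  ∀ s : S, Tendsto (fun p : ℕ × ℕ => gromovProduct (x p.1) (y p.2) s) atTop atTop

/-- The sequence converges at infinity: `(x_i, x_j)_s → ∞` as `i, j → ∞`. -/
def ConvergesAtInfinity (x : ℕ → S) : Prop :=
  SeqEquivalent x x

/-- The Gromov boundary: sequences converging at infinity modulo equivalence. (In a hyperbolic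
space `SeqEquivalent` is an equivalence relation on these sequences.) -/
def GromovBoundary (S : Type w) [MetricSpace S] : Type w :=
  Quot (fun x y : {x : ℕ → S // ConvergesAtInfinity x} => SeqEquivalent x.1 y.1)

/-- The sequence `x` of points of `S` converges to the boundary point `ξ`. -/
def ConvergesTo (x : ℕ → S) (ξ : GromovBoundary S) : Prop :=
  ∃ h : ConvergesAtInfinity x, Quot.mk _ ⟨x, h⟩ = ξ

end HyperbolicSpaces

section Actions

variable (G : Type u) [Group G] (S : Type w) [MetricSpace S] [MulAction G S]

/-- The limit set `Λ(G) ⊆ ∂S`: all boundary points that are limits of sequences of points of an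
orbit `G s`; this does not depend on the choice of `s`. -/
def limitSet : Set (GromovBoundary S) :=
  {ξ | ∃ (s : S) (g : ℕ → G), ConvergesTo (fun i => g i • s) ξ}

/-- The action is non-elementary: its limit set is infinite. -/
def IsNonElementaryAction : Prop :=
  (limitSet G S).Infinite

/-- The action is acylindrical. -/
def IsAcylindricalAction : Prop :=
  ∀ ε : ℝ, 0 < ε → ∃ R : ℝ, 0 < R ∧ ∃ N : ℕ, 0 < N ∧ ∀ x y : S, R ≤ dist x y →
    {g : G | dist x (g • x) ≤ ε ∧ dist y (g • y) ≤ ε}.encard ≤ N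

end Actions

/-- `G` is acylindrically hyperbolic: it admits a non-elementary acylindrical isometric action on
a hyperbolic space. -/
def IsAcylindricallyHyperbolic (G : Type u) [Group G] : Prop :=
  ∃ (S : Type w) (_ : MetricSpace S) (_ : MulAction G S) (_ : IsIsometricSMul G S),
    IsHyperbolicSpace S ∧ IsAcylindricalAction G S ∧ IsNonElementaryAction G S

/-- `K(G)`: the subgroup generated by all finite normal subgroups of `G`. Whenever `G` has a
largest finite normal subgroup, as acylindrically hyperbolic groups do, `K(G)` is that subgroup. -/
def finiteRadical (G : Type u) [Group G] : Subgroup G :=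
  sSup {N : Subgroup G | N.Normal ∧ Finite N}

/-- The action is essentially free: almost every point has trivial stabilizer. -/
def IsEssentiallyFree (G : Type u) [Group G] {X : Type v} [MeasurableSpace X] [MulAction G X]
    (ν : Measure X) : Prop :=
  ∀ᵐ x ∂ν, MulAction.stabilizer G x = ⊥

end AcylHyp

end

/-! By Poincaré recurrence, almost every stabilizer H is recurrent: for h in H and g in G, g^n h
g^(-n) lies in H for infinitely many n (`ae_recurrent_stabilizer`).

The geometric core (`infinite_limitSet_of_recurrent`) is that an infinite recurrent H has infinite
limit set; acylindricity passes to H. If h in H commutes with no power of a loxodromic f, it moves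
the repelling point of f, so f^n h f^(-n) o stays close to f^n o and recurrence puts the attracting
point of f in the limit set of H. Apply this to the conjugates of one loxodromic g by the powers of
an independent f. If it fails for all but finitely many of them, H fixes triples of boundary points,
hence coarsely fixes their centres, and acylindricity at two distant centres makes H finite.

Finiteness of the stabilizer is an invariant property, so ergodicity gives the dichotomy. A finite
subgroup that is a stabilizer with positive probability has finitely many conjugates, and
Dietzmann's lemma puts it inside a finite normal subgroup. -/

namespace AcylHyp

/-! ### Gromov products, the four-point condition, convergence at infinity -/

section GromovProducts

variable {S : Type w} [MetricSpace S]

/-- Gromov's four-point condition with constant `δ`. -/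
def FourPoint (S : Type w) [MetricSpace S] (δ : ℝ) : Prop :=
  ∀ x y z w : S, min (gromovProduct x y w) (gromovProduct y z w) ≤ gromovProduct x z w + δ

theorem gromovProduct_comm (x y z : S) : gromovProduct x y z = gromovProduct y x z := by
  simp only [gromovProduct, dist_comm x y]; ring

theorem gromovProduct_le_dist {x y w p : S} (h : dist x p + dist p y = dist x y) :
    gromovProduct x y w ≤ dist w p := by
  have h1 := dist_triangle x p w
  have h2 := dist_triangle y p w
  rw [dist_comm p w] at h1 h2
  rw [dist_comm y p] at h2
  unfold gromovProduct
  linarith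

theorem gromovProduct_eq_sub (x y w : S) :
    gromovProduct x y w = dist w x - gromovProduct w y x := by
  simp only [gromovProduct, dist_comm x w, dist_comm y w, dist_comm y x]; ring

theorem gromovProduct_le_left (x y w : S) : gromovProduct x y w ≤ dist w x := by
  have h1 := dist_triangle y x w
  rw [dist_comm y x, dist_comm x w] at h1
  simp only [gromovProduct]
  rw [dist_comm x w]
  linarith

theorem gromovProduct_le_add_left (x x' y w : S) :
    gromovProduct x y w ≤ gromovProduct x' y w + dist x x' := by
  have h1 := dist_triangle x x' w
  have h2 := dist_triangle x' x y
  rw [dist_comm x' x] at h2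
  simp only [gromovProduct]
  linarith

theorem gromovProduct_le_add_right (x y y' w : S) :
    gromovProduct x y w ≤ gromovProduct x y' w + dist y y' := by
  rw [gromovProduct_comm x y, gromovProduct_comm x y']
  exact gromovProduct_le_add_left y y' x w

theorem gromovProduct_le_add_base (x y w w' : S) :
    gromovProduct x y w ≤ gromovProduct x y w' + dist w w' := by
  have h1 := dist_triangle x w' w
  have h2 := dist_triangle y w' w
  rw [dist_comm w' w] at h1 h2
  simp only [gromovProduct]
  linarith

theorem dist_sub_le_gromovProduct (x y w : S) : dist w x - dist x y ≤ gromovProduct x y w := by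
  have h1 := dist_triangle w y x
  rw [dist_comm y x] at h1
  simp only [gromovProduct]
  rw [dist_comm x w, dist_comm y w]
  linarith

theorem FourPoint.nonneg {δ : ℝ} (h : FourPoint S δ) (o : S) : 0 ≤ δ := by
  have := h o o o o
  simp [gromovProduct] at this
  exact this

/-- A point on a geodesic side which realizes the Gromov product up to a constant. -/
theorem IsGeodesic.exists_dist_le {δ : ℝ} (hδ : SlimTriangles S δ)
    (hg : ∀ x y : S, ∃ γ : ℝ → S, IsGeodesic γ x y) {x y : S} (w : S) {α : ℝ → S}
    (hα : IsGeodesic α x y) :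
    ∃ s ∈ Icc (0 : ℝ) (dist x y), dist w (α s) ≤ gromovProduct x y w + 2 * δ + 2 := by
  obtain ⟨β, hβ⟩ := hg y w
  obtain ⟨γ, hγ⟩ := hg x w
  have hδ0 : 0 ≤ δ := by
    rcases hδ x y w α β γ hα hβ hγ 0 ⟨le_rfl, dist_nonneg⟩ with ⟨t, _, h⟩ | ⟨t, _, h⟩ <;>
      exact dist_nonneg.trans h
  let A : Set ℝ := {s | s ∈ Icc (0 : ℝ) (dist x y) ∧
    ∃ t ∈ Icc (0 : ℝ) (dist x w), dist (α s) (γ t) ≤ δ}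
  have hA0 : (0 : ℝ) ∈ A :=
    ⟨⟨le_rfl, dist_nonneg⟩, 0, ⟨le_rfl, dist_nonneg⟩, by rw [hα.source, hγ.source]; simpa⟩
  have hAb : BddAbove A := ⟨dist x y, fun s hs => hs.1.2⟩
  -- With s within 1 of the supremum, s + 2 cannot lie in A, so slimness puts it near the side from
  -- y to w. No continuity argument is needed.
  obtain ⟨s, hsA, hs⟩ := exists_lt_of_lt_csSup ⟨0, hA0⟩ (sub_one_lt (sSup A))
  -- A nearby parameter that is close to the third side.
  obtain ⟨s', hs', hss', t', ht', hd'⟩ : ∃ s' ∈ Icc (0 : ℝ) (dist x y), |s - s'| ≤ 2 ∧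
      ∃ t ∈ Icc (0 : ℝ) (dist y w), dist (α s') (β t) ≤ δ := by
    rcases le_or_gt (s + 2) (dist x y) with h | h
    · have hm : s + 2 ∈ Icc (0 : ℝ) (dist x y) := ⟨by linarith [hsA.1.1], h⟩
      refine ⟨s + 2, hm, by simp, ?_⟩
      rcases hδ x y w α β γ hα hβ hγ _ hm with h' | h'
      · exact h'
      · have := le_csSup hAb (show s + 2 ∈ A from ⟨hm, h'⟩)
        linarith
    · refine ⟨dist x y, ⟨dist_nonneg, le_rfl⟩, ?_, 0, ⟨le_rfl, dist_nonneg⟩, ?_⟩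
      · rw [abs_le]; constructor <;> linarith [hsA.1.2]
      · rw [hα.target, hβ.source]; simpa
  obtain ⟨hsI, t, ht, hd⟩ := hsA
  refine ⟨s, hsI, ?_⟩
  have e1 : dist x (α s) = s := by
    have := hα.isom 0 ⟨le_rfl, dist_nonneg⟩ s hsI
    rwa [hα.source, zero_sub, abs_neg, abs_of_nonneg hsI.1] at this
  have e2 : dist (α s) y = dist x y - s := by
    have := hα.isom s hsI _ ⟨dist_nonneg, le_rfl⟩
    rwa [hα.target, abs_sub_comm, abs_of_nonneg (by linarith [hsI.2])] at this
  have e3 : dist (α s) (α s') ≤ 2 := by rw [hα.isom s hsI s' hs']; exact hss'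
  have e4 : dist x (γ t) = t := by
    have := hγ.isom 0 ⟨le_rfl, dist_nonneg⟩ t ht
    rwa [hγ.source, zero_sub, abs_neg, abs_of_nonneg ht.1] at this
  have e5 : dist (γ t) w = dist x w - t := by
    have := hγ.isom t ht _ ⟨dist_nonneg, le_rfl⟩
    rwa [hγ.target, abs_sub_comm, abs_of_nonneg (by linarith [ht.2])] at this
  have e6 : dist y (β t') = t' := by
    have := hβ.isom 0 ⟨le_rfl, dist_nonneg⟩ t' ht'
    rwa [hβ.source, zero_sub, abs_neg, abs_of_nonneg ht'.1] at this
  have e7 : dist (β t') w = dist y w - t' := by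
    have := hβ.isom t' ht' _ ⟨dist_nonneg, le_rfl⟩
    rwa [hβ.target, abs_sub_comm, abs_of_nonneg (by linarith [ht'.2])] at this
  -- Going through γ t and through β t' gives two bounds on the distance from w to α s; in their
  -- average s cancels.
  have f1 := dist_triangle x (γ t) (α s)
  have f2 := dist_triangle w (γ t) (α s)
  have f3 := dist_triangle (α s) (β t') y
  have f4 := dist_triangle w (β t') (α s)
  have f5 := dist_triangle (α s) (α s') (β t')
  rw [dist_comm (γ t) (α s)] at f1 f2
  rw [dist_comm w (γ t)] at f2
  rw [dist_comm (β t') y] at f3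
  rw [dist_comm w (β t'), dist_comm (β t') (α s)] at f4
  unfold gromovProduct
  linarith

/-- The near point on the side xz is within δ of another side, whose Gromov product at w is at most
the distance from w to any of its points; hence 2δ + 2 plus δ. -/
theorem IsHyperbolicSpace.exists_fourPoint (h : IsHyperbolicSpace S) :
    ∃ δ : ℝ, FourPoint S δ := by
  obtain ⟨hg, δ, -, hδ⟩ := h
  refine ⟨3 * δ + 2, fun x y z w => ?_⟩
  obtain ⟨α, hα⟩ := hg x z
  obtain ⟨β, hβ⟩ := hg z y
  obtain ⟨γ, hγ⟩ := hg x y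
  obtain ⟨s, hs, hd⟩ := hα.exists_dist_le hδ hg w
  have key : ∀ {a b : S} {c : ℝ → S}, IsGeodesic c a b → ∀ t ∈ Icc (0 : ℝ) (dist a b),
      gromovProduct a b w ≤ dist w (c t) := by
    intro a b c hc t ht
    apply gromovProduct_le_dist
    have h1 := hc.isom 0 ⟨le_rfl, dist_nonneg⟩ t ht
    have h2 := hc.isom t ht _ ⟨dist_nonneg, le_rfl⟩
    rw [hc.source, zero_sub, abs_neg, abs_of_nonneg ht.1] at h1
    rw [hc.target, abs_sub_comm, abs_of_nonneg (by linarith [ht.2])] at h2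
    linarith
  rcases hδ x z y α β γ hα hβ hγ s hs with ⟨t, ht, h⟩ | ⟨t, ht, h⟩
  · refine (min_le_right _ _).trans ?_
    rw [gromovProduct_comm]
    linarith [key hβ t ht, dist_triangle w (α s) (β t)]
  · refine (min_le_left _ _).trans ?_
    linarith [key hγ t ht, dist_triangle w (α s) (γ t)]

/-- If `y` is close to `x` as seen from `w`, it may replace `x` in a small Gromov product. -/
theorem FourPoint.le_of_lt {δ : ℝ} (hS : FourPoint S δ) {x y z w : S} {C : ℝ}
    (h : gromovProduct x z w ≤ C) (h' : C + δ < gromovProduct x y w) :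
    gromovProduct y z w ≤ C + δ := by
  rcases min_le_iff.1 (hS x y z w) with h1 | h1 <;> linarith

/-- The workhorse for separation: both directions may be replaced by nearby ones at a cost of δ
each. -/
theorem FourPoint.le_of_lt_of_lt {δ : ℝ} (hS : FourPoint S δ) {x x' z z' w : S} {C : ℝ}
    (h : gromovProduct x z w ≤ C) (hx : C + 2 * δ < gromovProduct x x' w)
    (hz : C + 2 * δ < gromovProduct z z' w) : gromovProduct x' z' w ≤ C + 2 * δ := by
  have hδ := hS.nonneg w
  have h1 := hS.le_of_lt (y := x') h (by linarith)
  rw [gromovProduct_comm] at h1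
  have h2 := hS.le_of_lt (y := z') h1 (by linarith)
  rw [gromovProduct_comm]
  linarith

/-- Two coarse centres of the same triple are close to each other. -/
theorem FourPoint.dist_center_le {δ : ℝ} (hS : FourPoint S δ) {x y z p q : S} {C : ℝ}
    (p1 : gromovProduct x y p ≤ C) (p2 : gromovProduct y z p ≤ C) (p3 : gromovProduct x z p ≤ C)
    (q1 : gromovProduct x y q ≤ C) (q2 : gromovProduct y z q ≤ C)
    (q3 : gromovProduct x z q ≤ C) : dist p q ≤ 2 * (C + δ) := by
  have key : ∀ a, gromovProduct a q p ≤ C + δ → gromovProduct a p q ≤ C + δ →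
      dist p q ≤ 2 * (C + δ) := by
    intro a h1 h2
    simp only [gromovProduct, dist_comm q p] at h1 h2
    linarith
  -- Seen from p, at least two of the three vertices have small product with q; seen from q, at
  -- least two have small product with p. Some vertex does both, and its two products sum to the
  -- distance from p to q.
  have e1 := min_le_iff.1 ((hS x q y p).trans (add_le_add_left p1 δ))
  have e2 := min_le_iff.1 ((hS y q z p).trans (add_le_add_left p2 δ))
  have e3 := min_le_iff.1 ((hS x q z p).trans (add_le_add_left p3 δ))
  have f1 := min_le_iff.1 ((hS x p y q).trans (add_le_add_left q1 δ))
  have f2 := min_le_iff.1 ((hS y p z q).trans (add_le_add_left q2 δ))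
  have f3 := min_le_iff.1 ((hS x p z q).trans (add_le_add_left q3 δ))
  rw [gromovProduct_comm q] at e1 e2 e3
  rw [gromovProduct_comm p] at f1 f2 f3
  have kx := key x
  have ky := key y
  have kz := key z
  tauto

theorem seqEquivalent_iff (o : S) {x y : ℕ → S} : SeqEquivalent x y ↔
    ∀ M, ∃ N, ∀ i ≥ N, ∀ j ≥ N, M ≤ gromovProduct (x i) (y j) o := by
  constructor
  · intro h M
    obtain ⟨⟨a, b⟩, hab⟩ := eventually_atTop.1 (tendsto_atTop.1 (h o) M)
    exact ⟨max a b, fun i hi j hj =>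
      hab (i, j) ⟨(le_max_left _ _).trans hi, (le_max_right _ _).trans hj⟩⟩
  · intro h s
    refine tendsto_atTop.2 fun M => ?_
    obtain ⟨N, hN⟩ := h (M + dist o s)
    filter_upwards [eventually_ge_atTop (N, N)] with p hp
    linarith [hN p.1 hp.1 p.2 hp.2, gromovProduct_le_add_base (x p.1) (y p.2) o s]

theorem SeqEquivalent.symm {x y : ℕ → S} (h : SeqEquivalent x y) : SeqEquivalent y x := by
  intro s
  obtain h := (seqEquivalent_iff s).1 h
  refine (seqEquivalent_iff s).2 (fun M => ?_) s
  obtain ⟨N, hN⟩ := h M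
  exact ⟨N, fun i hi j hj => by rw [gromovProduct_comm]; exact hN j hj i hi⟩

theorem FourPoint.seqEquivalent_trans {δ : ℝ} (hS : FourPoint S δ) {x y z : ℕ → S}
    (h : SeqEquivalent x y) (h' : SeqEquivalent y z) : SeqEquivalent x z := by
  intro s
  refine (seqEquivalent_iff s).2 (fun M => ?_) s
  obtain ⟨N, hN⟩ := (seqEquivalent_iff s).1 h (M + δ)
  obtain ⟨N', hN'⟩ := (seqEquivalent_iff s).1 h' (M + δ)
  refine ⟨max N N', fun i hi j hj => ?_⟩
  have h1 := hN i ((le_max_left _ _).trans hi) (max N N') (le_max_left _ _)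
  have h2 := hN' (max N N') (le_max_right _ _) j ((le_max_right _ _).trans hj)
  linarith [le_min h1 h2, hS (x i) (y (max N N')) (z j) s]

/-- `Quot` only identifies along the generated equivalence; the four-point condition makes the
relation transitive, so nothing is added. -/
theorem FourPoint.mk_eq_mk_iff {δ : ℝ} (hS : FourPoint S δ)
    {x y : {x : ℕ → S // ConvergesAtInfinity x}} :
    (Quot.mk _ x : GromovBoundary S) = Quot.mk _ y ↔ SeqEquivalent x.1 y.1 := by
  refine ⟨fun h => ?_, fun h => Quot.sound h⟩
  have hgen := Quot.eqvGen_exact h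
  clear h
  induction hgen with
  | rel _ _ h => exact h
  | refl x => exact x.2
  | symm _ _ _ h => exact h.symm
  | trans _ _ _ _ _ hxy hyz => exact hS.seqEquivalent_trans hxy hyz

/-- Sequences converging to different boundary points have eventually bounded products. -/
theorem FourPoint.exists_bound_of_not_seqEquivalent {δ : ℝ} (hS : FourPoint S δ) (o : S)
    {x y : ℕ → S} (hx : ConvergesAtInfinity x) (hy : ConvergesAtInfinity y)
    (h : ¬ SeqEquivalent x y) :
    ∃ C N, ∀ i ≥ N, ∀ j ≥ N, gromovProduct (x i) (y j) o ≤ C := by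
  rw [seqEquivalent_iff o] at h
  push Not at h
  obtain ⟨M, hM⟩ := h
  obtain ⟨N, hN⟩ := (seqEquivalent_iff o).1 hx (M + 2 * δ + 1)
  obtain ⟨N', hN'⟩ := (seqEquivalent_iff o).1 hy (M + 2 * δ + 1)
  -- One late pair with small product suffices: later terms are close to it at infinity and inherit
  -- the bound.
  obtain ⟨i, hi, j, hj, hij⟩ := hM (max N N')
  refine ⟨M + 2 * δ, max N N', fun k hk l hl => ?_⟩
  exact hS.le_of_lt_of_lt hij.le
    (by linarith [hN i ((le_max_left _ _).trans hi) k ((le_max_left _ _).trans hk)])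
    (by linarith [hN' j ((le_max_right _ _).trans hj) l ((le_max_right _ _).trans hl)])

/-- A sequence converging at infinity leaves every ball. -/
theorem ConvergesAtInfinity.tendsto_dist {x : ℕ → S} (hx : ConvergesAtInfinity x) (o : S) :
    Tendsto (fun n => dist o (x n)) atTop atTop := by
  refine tendsto_atTop.2 fun M => ?_
  obtain ⟨N, hN⟩ := (seqEquivalent_iff o).1 hx M
  filter_upwards [eventually_ge_atTop N] with n hn
  exact (hN n hn n hn).trans (gromovProduct_le_left _ _ _)

/-- A sequence whose terms are asymptotic to those of a subsequence of a convergent one. -/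
theorem FourPoint.seqEquivalent_of_subseq {δ : ℝ} (hS : FourPoint S δ) (o : S) {x y : ℕ → S}
    (hx : ConvergesAtInfinity x) {φ : ℕ → ℕ} (hφ : ∀ n, n ≤ φ n)
    (h : Tendsto (fun n => gromovProduct (x (φ n)) (y n) o) atTop atTop) :
    SeqEquivalent x y := by
  refine (seqEquivalent_iff o).2 fun M => ?_
  obtain ⟨N, hN⟩ := (seqEquivalent_iff o).1 hx (M + δ)
  obtain ⟨N', hN'⟩ := eventually_atTop.1 (tendsto_atTop.1 h (M + δ))
  refine ⟨max N N', fun i hi j hj => ?_⟩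
  have h1 := hN i ((le_max_left _ _).trans hi) (φ j)
    (((le_max_left _ _).trans hj).trans (hφ j))
  have h2 := hN' j ((le_max_right _ _).trans hj)
  linarith [le_min h1 h2, hS (x i) (x (φ j)) (y j) o]

/-- Sequences at bounded distance of each other converge to the same point. -/
theorem SeqEquivalent.of_dist_le {x x' y y' : ℕ → S} (h : SeqEquivalent x y) {D D' : ℝ}
    (hD : ∀ n, dist (x n) (x' n) ≤ D) (hD' : ∀ n, dist (y n) (y' n) ≤ D') :
    SeqEquivalent x' y' := by
  intro o
  refine (seqEquivalent_iff o).2 (fun M => ?_) o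
  obtain ⟨N, hN⟩ := (seqEquivalent_iff o).1 h (M + D + D')
  refine ⟨N, fun i hi j hj => ?_⟩
  linarith [hN i hi j hj, gromovProduct_le_add_left (x i) (x' i) (y j) o,
    gromovProduct_le_add_right (x' i) (y j) (y' j) o, hD i, hD' j]

end GromovProducts

/-! ### Isometries and coarse centres -/

section Isometries

variable {G : Type u} [Group G] {S : Type w} [MetricSpace S] [MulAction G S]
  [IsIsometricSMul G S]

theorem gromovProduct_smul (g : G) (x y w : S) :
    gromovProduct (g • x) (g • y) (g • w) = gromovProduct x y w := by
  simp [gromovProduct]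

theorem gromovProduct_smul_left (g : G) (x y w : S) :
    gromovProduct (g • x) y w = gromovProduct x (g⁻¹ • y) (g⁻¹ • w) := by
  rw [← gromovProduct_smul g⁻¹, inv_smul_smul]

theorem SeqEquivalent.smul {x y : ℕ → S} (h : SeqEquivalent x y) (g : G) :
    SeqEquivalent (fun n => g • x n) (fun n => g • y n) := by
  intro s
  simpa only [gromovProduct_smul_left, inv_smul_smul] using h (g⁻¹ • s)

/-- An isometry moving three far away points by a bounded amount almost fixes their centre. -/
theorem FourPoint.dist_smul_center_le {δ : ℝ} (hS : FourPoint S δ) (h : G) {x y z p : S}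
    {C D : ℝ} (p1 : gromovProduct x y p ≤ C) (p2 : gromovProduct y z p ≤ C)
    (p3 : gromovProduct x z p ≤ C)
    (dx : dist x (h • x) ≤ D) (dy : dist y (h • y) ≤ D) (dz : dist z (h • z) ≤ D)
    (hx : D + C + 2 * δ < dist p x) (hy : D + C + 2 * δ < dist p y)
    (hz : D + C + 2 * δ < dist p z) : dist p (h • p) ≤ 2 * (C + 3 * δ) := by
  have hδ := hS.nonneg p
  -- Seen from h • p, each vertex and its image are close at infinity, so h • p is also a centre of
  -- the original triple. D affects only how far the vertices must be, not the conclusion.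
  have key : ∀ a, dist a (h • a) ≤ D → D + C + 2 * δ < dist p a →
      C + 2 * δ < gromovProduct (h • a) a (h • p) := by
    intro a h1 h2
    have := dist_sub_le_gromovProduct (h • a) a (h • p)
    rw [dist_smul, dist_comm (h • a)] at this
    linarith
  have kx := key x dx hx
  have ky := key y dy hy
  have kz := key z dz hz
  have q1 := hS.le_of_lt_of_lt ((gromovProduct_smul h x y p).le.trans p1) kx ky
  have q2 := hS.le_of_lt_of_lt ((gromovProduct_smul h y z p).le.trans p2) ky kz
  have q3 := hS.le_of_lt_of_lt ((gromovProduct_smul h x z p).le.trans p3) kx kz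
  have := hS.dist_center_le (p := p) (C := C + 2 * δ) (by linarith) (by linarith) (by linarith) q1 q2 q3
  linarith

end Isometries

/-! ### Loxodromic elements and their endpoints -/

section Loxodromic

variable {G : Type u} [Group G] {S : Type w} [MetricSpace S] [MulAction G S]

/-- `g` acts loxodromically: its orbit through `o` is unbounded and does not backtrack. -/
structure IsLoxodromic (g : G) (o : S) : Prop where
  bounded : ∃ C, ∀ m n : ℕ, gromovProduct ((g⁻¹) ^ m • o) (g ^ n • o) o ≤ C
  tendsto : Tendsto (fun n : ℕ => dist o (g ^ n • o)) atTop atTop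

theorem gromovProduct_nonneg (x y w : S) : 0 ≤ gromovProduct x y w := by
  have := dist_triangle x w y
  rw [dist_comm w y] at this
  simp only [gromovProduct]
  linarith

theorem gromovProduct_self_left (x w : S) : gromovProduct w x w = 0 := by
  simp [gromovProduct, dist_comm]

theorem gromovProduct_self_right (x w : S) : gromovProduct x w w = 0 := by
  simp [gromovProduct]

variable [IsIsometricSMul G S]

theorem dist_inv_smul_left (g : G) (x y : S) : dist (g⁻¹ • x) y = dist x (g • y) := by
  rw [← dist_smul g, smul_inv_smul]

/-- Local-to-global: seen from the (n+1)-st orbit point, o lies in nearly the direction of the n-th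
one by induction, so the backtracking bound at a single step persists at a cost of δ. -/
theorem gromovProduct_pow_step_le {δ : ℝ} (hS : FourPoint S δ) {g : G} {o : S} {C : ℝ}
    (hC : gromovProduct (g⁻¹ • o) (g • o) o ≤ C)
    (hg : 2 * C + 4 * δ + 1 ≤ dist o (g • o)) (n : ℕ) :
    gromovProduct o (g ^ (n + 1) • o) (g ^ n • o) ≤ C + δ := by
  have hδ := hS.nonneg o
  have hC0 := (gromovProduct_nonneg _ _ _).trans hC
  induction n with
  | zero => simp only [pow_zero, one_smul, gromovProduct_self_left]; linarith
  | succ n ih =>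
    have h1 : gromovProduct (g ^ n • o) (g ^ (n + 1 + 1) • o) (g ^ (n + 1) • o) ≤ C := by
      rw [← gromovProduct_smul (g ^ (n + 1))] at hC
      convert hC using 2
      · rw [pow_succ, smul_smul, mul_assoc, mul_inv_cancel, mul_one]
      · rw [pow_succ, mul_smul]
    refine hS.le_of_lt h1 ?_
    rw [gromovProduct_eq_sub, gromovProduct_comm]
    have : dist (g ^ (n + 1) • o) (g ^ n • o) = dist o (g • o) := by
      rw [pow_succ, mul_smul, dist_smul, dist_comm]
    linarith

/-- An isometry moving a point far, compared to its backtracking there, is loxodromic. -/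
theorem IsLoxodromic.of_le {δ : ℝ} (hS : FourPoint S δ) {g : G} {o : S} {C : ℝ}
    (hC : gromovProduct (g⁻¹ • o) (g • o) o ≤ C)
    (hg : 2 * C + 4 * δ + 1 ≤ dist o (g • o)) : IsLoxodromic g o := by
  have hδ := hS.nonneg o
  have hC0 := (gromovProduct_nonneg _ _ _).trans hC
  have hC' : gromovProduct (g⁻¹⁻¹ • o) (g⁻¹ • o) o ≤ C := by
    rw [inv_inv, gromovProduct_comm]; exact hC
  have hd : dist o (g⁻¹ • o) = dist o (g • o) := by
    rw [dist_comm, dist_inv_smul_left]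
  have hg' : 2 * C + 4 * δ + 1 ≤ dist o (g⁻¹ • o) := by rwa [hd]
  -- Each half-orbit stays in the direction of its first point, so the bound at one step controls
  -- all pairs of powers.
  have key : ∀ g : G, gromovProduct (g⁻¹ • o) (g • o) o ≤ C →
      2 * C + 4 * δ + 1 ≤ dist o (g • o) → 2 * C + 4 * δ + 1 ≤ dist o (g⁻¹ • o) →
      ∀ n : ℕ, C + 2 * δ < gromovProduct (g⁻¹ • o) ((g⁻¹) ^ (n + 1) • o) o := by
    intro g h1 h2 h2' n
    have h3 := gromovProduct_pow_step_le hS h1 h2 n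
    rw [← gromovProduct_smul ((g⁻¹) ^ (n + 1)), smul_smul, smul_smul] at h3
    rw [show (g⁻¹) ^ (n + 1) * g ^ (n + 1) = 1 by simp,
      show (g⁻¹) ^ (n + 1) * g ^ n = g⁻¹ by rw [pow_succ', mul_assoc]; simp, one_smul,
      gromovProduct_comm] at h3
    rw [gromovProduct_eq_sub]
    linarith
  constructor
  · refine ⟨C + 2 * δ, fun m n => ?_⟩
    rcases m with _ | m
    · simp only [pow_zero, one_smul, gromovProduct_self_left]; linarith
    rcases n with _ | n
    · simp only [pow_zero, one_smul, gromovProduct_self_right]; linarith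
    refine hS.le_of_lt_of_lt hC (key g hC hg hg' m) ?_
    have := key g⁻¹ hC' hg' (by rwa [inv_inv]) n
    rwa [inv_inv] at this
  · refine tendsto_atTop_mono (f := fun n : ℕ => (n : ℝ)) (fun n => ?_)
      tendsto_natCast_atTop_atTop
    induction n with
    | zero => simp
    | succ n ih =>
      have h1 := gromovProduct_pow_step_le hS hC hg n
      have h2 : dist (g ^ (n + 1) • o) (g ^ n • o) = dist o (g • o) := by
        rw [pow_succ, mul_smul, dist_smul, dist_comm]
      simp only [gromovProduct] at h1
      push_cast
      linarith

namespace IsLoxodromic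

variable {g : G} {o : S}

theorem inv (hg : IsLoxodromic g o) : IsLoxodromic g⁻¹ o := by
  obtain ⟨⟨C, hC⟩, ht⟩ := hg
  refine ⟨⟨C, fun m n => ?_⟩, ht.congr fun n => ?_⟩
  · rw [gromovProduct_comm, inv_inv]; exact hC n m
  · rw [inv_pow, dist_comm o ((g ^ n)⁻¹ • o), dist_inv_smul_left]

theorem conj (hg : IsLoxodromic g o) (a : G) : IsLoxodromic (a * g * a⁻¹) o := by
  obtain ⟨⟨C, hC⟩, ht⟩ := hg
  have e : (a * g * a⁻¹)⁻¹ = a * g⁻¹ * a⁻¹ := by group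
  refine ⟨⟨C + 3 * dist (a⁻¹ • o) o, fun m n => ?_⟩, ?_⟩
  · rw [e, conj_pow, conj_pow, mul_assoc, mul_assoc, mul_smul, mul_smul a,
      gromovProduct_smul_left, inv_smul_smul, mul_smul, mul_smul]
    have h1 := gromovProduct_le_add_base ((g⁻¹) ^ m • a⁻¹ • o) (g ^ n • a⁻¹ • o) (a⁻¹ • o) o
    have h2 := gromovProduct_le_add_left ((g⁻¹) ^ m • a⁻¹ • o) ((g⁻¹) ^ m • o)
      (g ^ n • a⁻¹ • o) o
    have h3 := gromovProduct_le_add_right ((g⁻¹) ^ m • o) (g ^ n • a⁻¹ • o) (g ^ n • o) o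
    rw [dist_smul] at h2 h3
    linarith [hC m n]
  · refine tendsto_atTop_mono (fun n => ?_)
      (tendsto_atTop_add_const_right atTop (-(2 * dist (a⁻¹ • o) o)) ht)
    rw [conj_pow, mul_assoc, mul_smul]
    rw [← dist_inv_smul_left a, mul_smul]
    have h1 := dist_triangle o (a⁻¹ • o) (g ^ n • a⁻¹ • o)
    have h2 := dist_triangle o (g ^ n • a⁻¹ • o) (g ^ n • o)
    rw [dist_smul] at h2
    rw [dist_comm o (a⁻¹ • o)] at h1
    linarith

/-- Translating the backtracking bound by g^i puts g^i o coarsely between o and g^j o, as on a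
geodesic ray. -/
theorem exists_dist_sub_le (hg : IsLoxodromic g o) :
    ∃ C, ∀ i j : ℕ, i ≤ j → dist o (g ^ i • o) - C ≤ gromovProduct (g ^ i • o) (g ^ j • o) o := by
  obtain ⟨C, hC⟩ := hg.bounded
  refine ⟨C, fun i j hij => ?_⟩
  have := hC i (j - i)
  rw [← gromovProduct_smul (g ^ i), smul_smul, smul_smul, ← pow_add, inv_pow, mul_inv_cancel,
    one_smul, Nat.add_sub_cancel' hij] at this
  rw [gromovProduct_eq_sub]
  linarith

theorem convergesAtInfinity (hg : IsLoxodromic g o) :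
    ConvergesAtInfinity (fun n : ℕ => g ^ n • o) := by
  obtain ⟨C, hC⟩ := hg.exists_dist_sub_le
  refine (seqEquivalent_iff o).2 fun M => ?_
  obtain ⟨N, hN⟩ := eventually_atTop.1 (tendsto_atTop.1 hg.tendsto (M + C))
  refine ⟨N, fun i hi j hj => ?_⟩
  rcases le_total i j with h | h
  · linarith [hC i j h, hN i hi]
  · rw [gromovProduct_comm]
    linarith [hC j i h, hN j hj]

/-- If `h` fixes the attracting point of `g`, it moves the positive orbit of `g` boundedly. -/
theorem exists_dist_le_of_seqEquivalent {δ : ℝ} (hS : FourPoint S δ) (hg : IsLoxodromic g o)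
    {h : G} (heq : SeqEquivalent (fun n : ℕ => g ^ n • o) (fun n : ℕ => h • g ^ n • o)) :
    ∃ D, ∀ n : ℕ, dist (g ^ n • o) (h • g ^ n • o) ≤ D := by
  obtain ⟨C, hC⟩ := hg.exists_dist_sub_le
  refine ⟨4 * dist o (h • o) + 2 * |C| + 4 * |δ|, fun n => ?_⟩
  obtain ⟨N, hN⟩ := (seqEquivalent_iff o).1 heq (dist o (g ^ n • o))
  have h1 := hC n (max n N) (le_max_left _ _)
  have h2 := hN (max n N) (le_max_right _ _) (max n N) (le_max_right _ _)
  have h3 := h1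
  rw [← gromovProduct_smul h] at h3
  have h4 := gromovProduct_le_add_base (h • g ^ n • o) (h • g ^ (max n N) • o) (h • o) o
  rw [dist_comm (h • o) o] at h4
  have h5 := hS (g ^ n • o) (g ^ (max n N) • o) (h • g ^ (max n N) • o) o
  have h6 := hS (g ^ n • o) (h • g ^ (max n N) • o) (h • g ^ n • o) o
  rw [gromovProduct_comm (h • g ^ (max n N) • o)] at h6
  have h7 : dist o (g ^ n • o) - dist o (h • o) - |C| - 2 * |δ| ≤
      gromovProduct (g ^ n • o) (h • g ^ n • o) o := by
    have c1 := le_abs_self C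
    have c2 := abs_nonneg C
    have c3 := le_abs_self δ
    have c4 := abs_nonneg δ
    have c5 := dist_nonneg (x := o) (y := h • o)
    rcases min_le_iff.1 h5 with h5 | h5 <;> rcases min_le_iff.1 h6 with h6 | h6 <;> linarith
  have h8 := dist_triangle o (h • o) (h • g ^ n • o)
  rw [dist_smul] at h8
  simp only [gromovProduct] at h7
  rw [dist_comm (g ^ n • o) o, dist_comm (h • g ^ n • o) o] at h7
  linarith [dist_nonneg (x := o) (y := h • o)]

/-- In an acylindrical action, an element fixing the attracting point of a loxodromic element
commutes with a power of it. -/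
theorem exists_commute_pow {δ : ℝ} (hS : FourPoint S δ) (hac : IsAcylindricalAction G S)
    (hg : IsLoxodromic g o) {h : G}
    (heq : SeqEquivalent (fun n : ℕ => g ^ n • o) (fun n : ℕ => h • g ^ n • o)) :
    ∃ k : ℕ, 0 < k ∧ Commute h (g ^ k) := by
  obtain ⟨D, hD⟩ := hg.exists_dist_le_of_seqEquivalent hS heq
  obtain ⟨R, -, N, -, hN⟩ := hac (max D 1) (lt_max_of_lt_right one_pos)
  obtain ⟨M, hM⟩ := (tendsto_atTop.1 hg.tendsto R).exists
  have hfin : {u : G | dist o (u • o) ≤ max D 1 ∧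
      dist ((g ^ M)⁻¹ • o) (u • (g ^ M)⁻¹ • o) ≤ max D 1}.Finite := by
    refine Set.finite_of_encard_le_coe (hN o ((g ^ M)⁻¹ • o) ?_)
    rwa [dist_comm, dist_inv_smul_left]
  have hmem : ∀ n ∈ Ici M, (g ^ n)⁻¹ * h * g ^ n ∈ {u : G | dist o (u • o) ≤ max D 1 ∧
      dist ((g ^ M)⁻¹ • o) (u • (g ^ M)⁻¹ • o) ≤ max D 1} := by
    -- For n ≥ M the displacements of g^(-n) h g^n at o and at g^(-M) o are those of h at g^n o and
    -- g^(n-M) o, both on the positive orbit. The pigeonhole principle then gives two equal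
    -- conjugates.
    intro n hn
    constructor
    · refine le_trans ?_ (le_max_left _ _)
      rw [mul_assoc, mul_smul, dist_comm, dist_inv_smul_left, dist_comm, mul_smul]
      exact hD n
    · refine le_trans ?_ (le_max_left _ _)
      rw [dist_comm, mul_assoc, mul_smul, dist_inv_smul_left, dist_comm, mul_smul, smul_smul,
        ← pow_sub g hn]
      exact hD _
  obtain ⟨m, -, n, -, hmn, he⟩ :=
    (Set.Ici_infinite M).exists_lt_map_eq_of_mapsTo hmem hfin
  refine ⟨n - m, Nat.sub_pos_of_lt hmn, ?_⟩
  rw [pow_sub g hmn.le, Commute, SemiconjBy]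
  calc h * (g ^ n * (g ^ m)⁻¹) = g ^ n * ((g ^ n)⁻¹ * h * g ^ n) * (g ^ m)⁻¹ := by group
    _ = g ^ n * (g ^ m)⁻¹ * h := by rw [← he]; group

theorem not_commute_inv_pow {h : G} (hc : ∀ k : ℕ, 0 < k → ¬ Commute h (g ^ k)) (k : ℕ)
    (hk : 0 < k) : ¬ Commute h ((g⁻¹) ^ k) := by
  intro h'
  rw [inv_pow] at h'
  exact hc k hk (Commute.inv_right_iff.1 h')

theorem dist_pow_mul_le {h : G} {k : ℕ} (hc : Commute h (g ^ k)) (p : S) (n : ℕ) :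
    dist (g ^ (k * n) • p) (h • g ^ (k * n) • p) ≤ dist p (h • p) := by
  rw [pow_mul, smul_smul, (hc.pow_right n).eq, mul_smul, dist_smul]

/-- The attracting points of two loxodromic elements with commuting powers. -/
theorem seqEquivalent_or_of_commute {δ : ℝ} (hS : FourPoint S δ) {f : G}
    (hf : IsLoxodromic f o) (hg : IsLoxodromic g o) {k l : ℕ} (hk : 0 < k) (hl : 0 < l)
    (hc : Commute (f ^ k) (g ^ l)) :
    SeqEquivalent (fun n : ℕ => g ^ n • o) (fun n : ℕ => f ^ n • o) ∨
      SeqEquivalent (fun n : ℕ => g ^ n • o) (fun n : ℕ => (f⁻¹) ^ n • o) := by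
  by_contra hcon
  push Not at hcon
  obtain ⟨C₁, N₁, h₁⟩ := hS.exists_bound_of_not_seqEquivalent o hg.convergesAtInfinity
    hf.convergesAtInfinity hcon.1
  obtain ⟨C₂, N₂, h₂⟩ := hS.exists_bound_of_not_seqEquivalent o hg.convergesAtInfinity
    hf.inv.convergesAtInfinity hcon.2
  obtain ⟨C₃, h₃⟩ := hf.bounded
  set C := max C₁ (max C₂ C₃)
  have hC₁ : C₁ ≤ C := le_max_left _ _
  have hC₂ : C₂ ≤ C := (le_max_left _ _).trans (le_max_right _ _)
  have hC₃ : C₃ ≤ C := (le_max_right _ _).trans (le_max_right _ _)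
  -- If the attracting point of g avoids both ends of f, then o is a coarse centre of the three. The
  -- powers of f^k displace points far along each of the three orbits by bounded amounts, so they
  -- displace o by an amount independent of j, contradicting loxodromicity.
  have key : ∀ j : ℕ, dist o (f ^ (k * j) • o) ≤ 2 * (C + 3 * δ) := by
    intro j
    set h := f ^ (k * j) with hh
    have hhg : Commute h (g ^ l) := by rw [hh, pow_mul]; exact hc.pow_left j
    have hhf : Commute h (f ^ 1) := by rw [hh]; exact (Commute.refl f).pow_pow _ _
    have hhf' : Commute h ((f⁻¹) ^ 1) := by
      rw [inv_pow]; exact hhf.inv_right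
    have hmul : Tendsto (fun n : ℕ => l * n) atTop atTop :=
      tendsto_id.const_mul_atTop' hl
    have e1 := (hg.tendsto.comp hmul).eventually_gt_atTop (dist o (h • o) + C + 2 * δ)
    have e2 := hf.tendsto.eventually_gt_atTop (dist o (h • o) + C + 2 * δ)
    have e3 := hf.inv.tendsto.eventually_gt_atTop (dist o (h • o) + C + 2 * δ)
    obtain ⟨n, e1, e2, e3, e4, e5, e6⟩ := (e1.and (e2.and (e3.and
      ((eventually_ge_atTop N₁).and ((eventually_ge_atTop N₂).and
        (hmul.eventually_ge_atTop (max N₁ N₂))))))).exists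
    refine hS.dist_smul_center_le h (x := g ^ (l * n) • o) (y := f ^ n • o)
      (z := (f⁻¹) ^ n • o) (C := C) (D := dist o (h • o)) ?_ ?_ ?_ (dist_pow_mul_le hhg o n)
      ?_ ?_ e1 e2 e3
    · exact (h₁ _ ((le_max_left _ _).trans e6) n e4).trans hC₁
    · rw [gromovProduct_comm]; exact (h₃ n n).trans hC₃
    · exact (h₂ _ ((le_max_right _ _).trans e6) n e5).trans hC₂
    · simpa using dist_pow_mul_le hhf o n
    · simpa using dist_pow_mul_le hhf' o n
  have hmul : Tendsto (fun n : ℕ => k * n) atTop atTop := tendsto_id.const_mul_atTop' hk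
  obtain ⟨j, hj⟩ := ((hf.tendsto.comp hmul).eventually_gt_atTop (2 * (C + 3 * δ))).exists
  exact (key j).not_gt hj

end IsLoxodromic

/-! ### Producing independent loxodromic elements -/

theorem gromovProduct_mul_smul (a b : G) (o : S) :
    gromovProduct (a • o) ((a * b) • o) o = dist o (a • o) - gromovProduct (a⁻¹ • o) (b • o) o := by
  rw [gromovProduct_eq_sub, ← gromovProduct_smul a⁻¹ o, inv_smul_smul, smul_smul,
    inv_mul_cancel_left]

/-- A group with two distinct limit points contains a loxodromic element. -/
theorem exists_isLoxodromic {δ : ℝ} (hS : FourPoint S δ) {o : S} {a b : ℕ → G}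
    (ha : ConvergesAtInfinity fun i => a i • o) (hb : ConvergesAtInfinity fun i => b i • o)
    (hab : ¬ SeqEquivalent (fun i => a i • o) (fun i => b i • o)) :
    ∃ g : G, IsLoxodromic g o := by
  by_contra! hno
  have hδ := hS.nonneg o
  -- Without loxodromics, g o and g⁻¹ o always point in nearly the same direction.
  have key : ∀ g : G, dist o (g • o) - 4 * δ - 1 ≤ 2 * gromovProduct (g • o) (g⁻¹ • o) o := by
    intro g
    by_contra! h
    rw [gromovProduct_comm] at h
    exact hno g (.of_le hS le_rfl (by linarith))
  obtain ⟨B, N, hB⟩ := hS.exists_bound_of_not_seqEquivalent o ha hb hab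
  obtain ⟨i, hi, hiN⟩ := (((ha.tendsto_dist o).eventually_gt_atTop (2 * |B| + 12 * δ + 2)).and
    (eventually_ge_atTop N)).exists
  obtain ⟨j, hj, hjN⟩ := (((hb.tendsto_dist o).eventually_gt_atTop (2 * |B| + 12 * δ + 2)).and
    (eventually_ge_atTop N)).exists
  have hB0 := abs_nonneg B
  have hij := (hB i hiN j hjN).trans (le_abs_self B)
  generalize |B| = B at *
  generalize a i = a at *
  generalize b j = b at *
  have ka := key a
  have kb := key b
  have h1 := hS.le_of_lt hij (y := a⁻¹ • o) (by linarith)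
  have h2 : gromovProduct (b⁻¹ • o) (a • o) o ≤ B + δ := by
    rw [gromovProduct_comm] at hij
    exact hS.le_of_lt hij (by linarith)
  have h3 := gromovProduct_mul_smul a b o
  have h4 := gromovProduct_mul_smul b⁻¹ a⁻¹ o
  rw [inv_inv, dist_comm o (b⁻¹ • o), dist_inv_smul_left, gromovProduct_comm (b • o)] at h4
  -- ab o points towards a o and its inverse image b⁻¹a⁻¹ o towards b⁻¹ o, directions already
  -- separated; so ab is loxodromic after all.
  have h5 := hS.le_of_lt_of_lt (x' := (b⁻¹ * a⁻¹) • o) (z' := (a * b) • o) h2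
    (by linarith) (by linarith)
  rw [← mul_inv_rev] at h5
  refine hno (a * b) (.of_le hS h5 ?_)
  have h6 : gromovProduct (a⁻¹ • o) (b • o) o =
      (dist o (a • o) + dist o (b • o) - dist o ((a * b) • o)) / 2 := by
    rw [gromovProduct, dist_inv_smul_left, dist_inv_smul_left, mul_smul, dist_comm (b • o)]
  linarith

theorem exists_convergesAtInfinity_of_mem_limitSet {ξ : GromovBoundary S}
    (hξ : ξ ∈ limitSet G S) (o : S) :
    ∃ (a : ℕ → G) (h : ConvergesAtInfinity fun i => a i • o), Quot.mk _ ⟨_, h⟩ = ξ := by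
  obtain ⟨s, a, hs, rfl⟩ := hξ
  have hd : ∀ n, dist (a n • s) (a n • o) ≤ dist s o := fun n => (dist_smul _ _ _).le
  refine ⟨a, SeqEquivalent.of_dist_le hs hd hd, (Quot.sound ?_).symm⟩
  exact SeqEquivalent.of_dist_le hs (D := 0) (fun n => by simp) hd

/-- Orbit points are approximated by translates of the endpoints of a loxodromic element. -/
theorem IsLoxodromic.exists_frequently_le {δ : ℝ} (hS : FourPoint S δ) {f : G} {o : S}
    (hf : IsLoxodromic f o) :
    ∃ C, ∀ a : G, ∃ g : G, IsLoxodromic g o ∧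
      ∃ᶠ n : ℕ in atTop, dist o (a • o) - C ≤ gromovProduct (a • o) ((a * g ^ n) • o) o := by
  obtain ⟨C, hC⟩ := hf.bounded
  refine ⟨C + δ, fun a => ?_⟩
  simp only [gromovProduct_mul_smul, sub_le_sub_iff_left]
  -- The point a⁻¹ o cannot lie towards both ends of f, so one sign works for infinitely many n,
  -- with C uniform in a.
  have hsplit : ∀ n : ℕ, gromovProduct (a⁻¹ • o) ((f⁻¹) ^ n • o) o ≤ C + δ ∨
      gromovProduct (a⁻¹ • o) (f ^ n • o) o ≤ C + δ := by
    intro n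
    rw [gromovProduct_comm _ ((f⁻¹) ^ n • o)]
    exact min_le_iff.1 ((hS _ _ _ _).trans (by linarith [hC n n]))
  rcases frequently_or_distrib.1 (Frequently.of_forall (f := atTop) hsplit) with h | h
  · exact ⟨f⁻¹, hf.inv, h⟩
  · exact ⟨f, hf, h⟩

/-- The conjugates have attracting points near a_i o and b_i o respectively, and these orbit points
tend to distinct boundary points. -/
theorem eventually_not_seqEquivalent_conj {δ : ℝ} (hS : FourPoint S δ) {o : S} {a b : ℕ → G}
    (ha : ConvergesAtInfinity fun i => a i • o) (hb : ConvergesAtInfinity fun i => b i • o)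
    (hab : ¬ SeqEquivalent (fun i => a i • o) (fun i => b i • o)) (C : ℝ) :
    ∀ᶠ i in atTop, ∀ f g : G,
      (∃ᶠ n : ℕ in atTop,
        dist o (a i • o) - C ≤ gromovProduct (a i • o) ((a i * f ^ n) • o) o) →
      (∃ᶠ n : ℕ in atTop,
        dist o (b i • o) - C ≤ gromovProduct (b i • o) ((b i * g ^ n) • o) o) →
      ¬ SeqEquivalent (fun n : ℕ => (a i * f * (a i)⁻¹) ^ n • o)
        (fun n : ℕ => (b i * g * (b i)⁻¹) ^ n • o) := by
  have hδ := hS.nonneg o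
  obtain ⟨B, N, hB⟩ := hS.exists_bound_of_not_seqEquivalent o ha hb hab
  filter_upwards [(ha.tendsto_dist o).eventually_gt_atTop (B + C + 2 * δ),
    (hb.tendsto_dist o).eventually_gt_atTop (B + C + 2 * δ), eventually_ge_atTop N]
    with i hai hbi hi f g hf hg heq
  have hd : ∀ (a f : G) (n : ℕ), dist ((a * f * a⁻¹) ^ n • o) ((a * f ^ n) • o) ≤
      dist (a⁻¹ • o) o := by
    intro a f n
    rw [conj_pow, mul_smul _ a⁻¹, dist_smul]
  have heq' := heq.of_dist_le (hd (a i) f) (hd (b i) g)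
  obtain ⟨M, hM⟩ := (seqEquivalent_iff o).1 heq' (B + 2 * δ + 1)
  obtain ⟨m, hm, hmM⟩ := (hf.and_eventually (eventually_ge_atTop M)).exists
  obtain ⟨n, hn, hnM⟩ := (hg.and_eventually (eventually_ge_atTop M)).exists
  have := hS.le_of_lt_of_lt (hB i hi i hi) (x' := (a i * f ^ m) • o) (z' := (b i * g ^ n) • o)
    (by linarith) (by linarith)
  linarith [hM m hmM n hnM]

/-- A non-elementary action has two loxodromic elements without commuting powers. -/
theorem IsNonElementaryAction.exists_not_commute {δ : ℝ} (hS : FourPoint S δ)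
    (hG : IsNonElementaryAction G S) (o : S) :
    ∃ f g : G, IsLoxodromic f o ∧ IsLoxodromic g o ∧
      ∀ k l : ℕ, 0 < k → 0 < l → ¬ Commute (f ^ k) (g ^ l) := by
  let ξ := hG.natEmbedding
  choose a ha hξ using fun k => exists_convergesAtInfinity_of_mem_limitSet (ξ k).2 o
  have hne : ∀ k l, k ≠ l → ¬ SeqEquivalent (fun i => a k i • o) (fun i => a l i • o) := by
    intro k l hkl h
    refine hkl (ξ.injective (Subtype.ext ?_))
    rw [← hξ k, ← hξ l]
    exact Quot.sound h
  obtain ⟨f, hf⟩ := exists_isLoxodromic hS (ha 0) (ha 1) (hne 0 1 (by decide))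
  obtain ⟨C, hC⟩ := hf.exists_frequently_le hS
  obtain ⟨i, h01, h02, h12⟩ :=
    ((eventually_not_seqEquivalent_conj hS (ha 0) (ha 1) (hne 0 1 (by decide)) C).and
    ((eventually_not_seqEquivalent_conj hS (ha 0) (ha 2) (hne 0 2 (by decide)) C).and
    (eventually_not_seqEquivalent_conj hS (ha 1) (ha 2) (hne 1 2 (by decide)) C))).exists
  choose g hg hgC using fun k => hC (a k i)
  have e01 := h01 _ _ (hgC 0) (hgC 1)
  have e02 := h02 _ _ (hgC 0) (hgC 2)
  have e12 := h12 _ _ (hgC 1) (hgC 2)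
  have hl : ∀ k, IsLoxodromic (a k i * g k * (a k i)⁻¹) o := fun k => (hg k).conj _
  -- Three elements are needed: if the first has powers commuting with powers of both others, their
  -- attracting points both equal its repelling point.
  by_contra! hcon
  obtain ⟨k, l, hk, hl', hc⟩ := hcon _ _ (hl 0) (hl 1)
  obtain ⟨k', l', hk', hl'', hc'⟩ := hcon _ _ (hl 0) (hl 2)
  rcases (hl 0).seqEquivalent_or_of_commute hS (hl 1) hk hl' hc with h | h
  · exact e01 h.symm
  rcases (hl 0).seqEquivalent_or_of_commute hS (hl 2) hk' hl'' hc' with hh | hh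
  · exact e02 hh.symm
  exact e12 (hS.seqEquivalent_trans h hh.symm)

/-! ### Limit sets of recurrent subgroups -/

/-- A recurrent subgroup accumulates at the attracting point of every loxodromic element no power
of which it centralizes. -/
theorem IsLoxodromic.mk_mem_limitSet {δ : ℝ} (hS : FourPoint S δ)
    (hac : IsAcylindricalAction G S) {f : G} {o : S} (hf : IsLoxodromic f o) {H : Subgroup G}
    {h : G} (hrec : ∃ᶠ n : ℕ in atTop, f ^ n * h * (f ^ n)⁻¹ ∈ H)
    (hc : ∀ k : ℕ, 0 < k → ¬ Commute h (f ^ k)) :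
    (Quot.mk _ ⟨_, hf.convergesAtInfinity⟩ : GromovBoundary S) ∈ limitSet H S := by
  have hne : ¬ SeqEquivalent (fun n : ℕ => (f⁻¹) ^ n • o) (fun n : ℕ => h • (f⁻¹) ^ n • o) := by
    intro h'
    obtain ⟨k, hk, hk'⟩ := hf.inv.exists_commute_pow hS hac h'
    exact IsLoxodromic.not_commute_inv_pow hc k hk hk'
  have hconv := hf.inv.convergesAtInfinity
  obtain ⟨B, N, hB⟩ := hS.exists_bound_of_not_seqEquivalent o hconv
    (SeqEquivalent.smul hconv h) hne
  choose φ hφ hφH using fun n => frequently_atTop.1 hrec (max n N)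
  have hle : ∀ n, n ≤ φ n := fun n => (le_max_left _ _).trans (hφ n)
  have hseq : SeqEquivalent (fun n : ℕ => f ^ n • o)
      (fun n => (⟨_, hφH n⟩ : H) • o) := by
    refine hS.seqEquivalent_of_subseq o hf.convergesAtInfinity hle ?_
    -- The product of f^m o with f^m h f^(-m) o is d(o, f^m o) minus the product of f^(-m) o with h
    -- f^(-m) o, bounded because h moves the repelling point.
    refine tendsto_atTop_mono (fun n => ?_) (tendsto_atTop_add_const_right atTop (-B)
      (hf.tendsto.comp (tendsto_atTop_mono hle tendsto_id)))
    have h1 := hB (φ n) ((le_max_right _ _).trans (hφ n)) (φ n) ((le_max_right _ _).trans (hφ n))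
    change _ ≤ gromovProduct (f ^ φ n • o) ((f ^ φ n * h * (f ^ φ n)⁻¹) • o) o
    rw [mul_assoc, gromovProduct_mul_smul, mul_smul]
    rw [inv_pow] at h1
    simp only [Function.comp_apply]
    linarith
  refine ⟨o, fun n => ⟨_, hφH n⟩, hS.seqEquivalent_trans hseq.symm hseq, ?_⟩
  exact hS.mk_eq_mk_iff.2 hseq.symm

/-- A recurrent subgroup of a group with a non-elementary acylindrical action on a hyperbolic
space is finite or has infinite limit set. -/
theorem infinite_limitSet_of_recurrent {δ : ℝ} (hS : FourPoint S δ)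
    (hac : IsAcylindricalAction G S) (hG : IsNonElementaryAction G S) (H : Subgroup G)
    (hrec : ∀ h ∈ H, ∀ g : G, ∃ᶠ n : ℕ in atTop, g ^ n * h * (g ^ n)⁻¹ ∈ H)
    (hH : Infinite H) : (limitSet H S).Infinite := by
  obtain ⟨_, o, -⟩ := hG.nonempty
  obtain ⟨f, g, hf, hg, hfg⟩ := hG.exists_not_commute hS o
  -- The points `f ^ i • ζ`, for `ζ` the attracting point of `g`, are pairwise distinct.
  have hne : ∀ i j : ℕ, i < j →
      ¬ SeqEquivalent (fun n : ℕ => f ^ i • g ^ n • o) (fun n : ℕ => f ^ j • g ^ n • o) := by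
    intro i j hij h
    have h' := h.smul (f ^ i)⁻¹
    simp only [inv_smul_smul] at h'
    obtain ⟨l, hl, hl'⟩ := hg.exists_commute_pow hS hac (h := f ^ (j - i)) (by
      convert h' using 2 with n
      rw [← Nat.sub_add_cancel hij.le, add_comm (j - i), pow_add, Nat.add_sub_cancel_left,
        mul_smul, inv_smul_smul])
    exact hfg _ _ (Nat.sub_pos_of_lt hij) hl hl'
  have hl : ∀ i : ℕ, IsLoxodromic (f ^ i * g * (f ^ i)⁻¹) o := fun i => hg.conj _
  have hd : ∀ i n : ℕ, dist ((f ^ i * g * (f ^ i)⁻¹) ^ n • o) (f ^ i • g ^ n • o) ≤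
      dist ((f ^ i)⁻¹ • o) o := by
    intro i n
    rw [conj_pow, mul_smul, mul_smul, dist_smul, dist_smul]
  let ζ : ℕ → GromovBoundary S := fun i => Quot.mk _ ⟨_, (hl i).convergesAtInfinity⟩
  have hζ : Function.Injective ζ := by
    have : ∀ i j, i < j → ζ i ≠ ζ j := fun i j hij h =>
      hne i j hij ((hS.mk_eq_mk_iff.1 h).of_dist_le (hd i) (hd j))
    intro i j h
    by_contra hij
    rcases Nat.lt_or_gt_of_ne hij with h' | h'
    · exact this _ _ h' h
    · exact this _ _ h' h.symm
  by_cases hfreq : ∃ᶠ i : ℕ in atTop, ∃ h ∈ H, ∀ k : ℕ, 0 < k →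
      ¬ Commute h ((f ^ i * g * (f ^ i)⁻¹) ^ k)
  · refine ((Nat.frequently_atTop_iff_infinite.1 hfreq).image hζ.injOn).mono ?_
    rintro _ ⟨i, ⟨h, hh, hc⟩, rfl⟩
    exact (hl i).mk_mem_limitSet hS hac (hrec h hh _) hc
  -- Otherwise `H` fixes `f ^ i • ζ` for all large `i`, and almost fixes `f ^ i • o`.
  exfalso
  rw [not_frequently] at hfreq
  push Not at hfreq
  obtain ⟨I, hI⟩ := eventually_atTop.1 hfreq
  -- The constants come from the triple 0, 1, 2 seen from f o; translating by f^i makes them serve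
  -- every triple i, i+1, i+2 with centre f^(i+1) o.
  obtain ⟨C₁, N₁, h₁⟩ := hS.exists_bound_of_not_seqEquivalent (f • o)
    (SeqEquivalent.smul hg.convergesAtInfinity (f ^ 0))
    (SeqEquivalent.smul hg.convergesAtInfinity (f ^ 1)) (hne 0 1 (by decide))
  obtain ⟨C₂, N₂, h₂⟩ := hS.exists_bound_of_not_seqEquivalent (f • o)
    (SeqEquivalent.smul hg.convergesAtInfinity (f ^ 1))
    (SeqEquivalent.smul hg.convergesAtInfinity (f ^ 2)) (hne 1 2 (by decide))
  obtain ⟨C₃, N₃, h₃⟩ := hS.exists_bound_of_not_seqEquivalent (f • o)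
    (SeqEquivalent.smul hg.convergesAtInfinity (f ^ 0))
    (SeqEquivalent.smul hg.convergesAtInfinity (f ^ 2)) (hne 0 2 (by decide))
  set C := max C₁ (max C₂ C₃)
  have hC₁ : C₁ ≤ C := le_max_left _ _
  have hC₂ : C₂ ≤ C := (le_max_left _ _).trans (le_max_right _ _)
  have hC₃ : C₃ ≤ C := (le_max_right _ _).trans (le_max_right _ _)
  have hmove : ∀ h ∈ H, ∀ i ≥ I, dist (f ^ (i + 1) • o) (h • f ^ (i + 1) • o) ≤
      2 * (C + 3 * δ) := by
    intro h hh i hi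
    choose k hk hc using fun j => hI (i + j) (hi.trans (Nat.le_add_right _ _)) h hh
    let D := max (dist (f ^ (i + 0) • o) (h • f ^ (i + 0) • o))
      (max (dist (f ^ (i + 1) • o) (h • f ^ (i + 1) • o))
      (dist (f ^ (i + 2) • o) (h • f ^ (i + 2) • o)))
    have hDm : ∀ j n, dist (f ^ (i + j) • g ^ (k j * n) • o)
        (h • f ^ (i + j) • g ^ (k j * n) • o) ≤ dist (f ^ (i + j) • o) (h • f ^ (i + j) • o) := by
      intro j n
      have := IsLoxodromic.dist_pow_mul_le (hc j) (f ^ (i + j) • o) n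
      rwa [conj_pow, mul_smul _ (f ^ (i + j))⁻¹, inv_smul_smul, mul_smul] at this
    have hmul : ∀ j, Tendsto (fun n : ℕ => k j * n) atTop atTop :=
      fun j => tendsto_id.const_mul_atTop' (hk j)
    have hfar : ∀ j, ∀ᶠ n : ℕ in atTop,
        D + C + 2 * δ < dist (f ^ (i + 1) • o) (f ^ (i + j) • g ^ (k j * n) • o) := by
      intro j
      have := ConvergesAtInfinity.tendsto_dist
        (SeqEquivalent.smul hg.convergesAtInfinity (f ^ (i + j))) (f ^ (i + 1) • o)
      exact (this.comp (hmul j)).eventually_gt_atTop _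
    have hlarge : ∀ j, ∀ᶠ n : ℕ in atTop, max N₁ (max N₂ N₃) ≤ k j * n :=
      fun j => (hmul j).eventually_ge_atTop _
    obtain ⟨n, a0, a1, a2, b0, b1, b2⟩ := ((hfar 0).and ((hfar 1).and ((hfar 2).and
      ((hlarge 0).and ((hlarge 1).and (hlarge 2)))))).exists
    simp only [max_le_iff] at b0 b1 b2
    have htr : ∀ a b m n, gromovProduct (f ^ (i + a) • g ^ m • o) (f ^ (i + b) • g ^ n • o)
        (f ^ (i + 1) • o) = gromovProduct (f ^ a • g ^ m • o) (f ^ b • g ^ n • o) (f • o) := by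
      intro a b m n
      simp only [pow_add _ i, mul_smul, gromovProduct_smul, pow_one]
    refine hS.dist_smul_center_le h (D := D) ?_ ?_ ?_
      ((hDm 0 n).trans (le_max_left _ _))
      ((hDm 1 n).trans ((le_max_left _ _).trans (le_max_right _ _)))
      ((hDm 2 n).trans ((le_max_right _ _).trans (le_max_right _ _))) a0 a1 a2
    · rw [htr]; exact (h₁ _ b0.1 _ b1.1).trans hC₁
    · rw [htr]; exact (h₂ _ b1.2.1 _ b2.2.1).trans hC₂
    · rw [htr]; exact (h₃ _ b0.2.2 _ b2.2.2).trans hC₃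
  -- The displacement bound depends on neither h nor i, so all of H coarsely fixes two centres as
  -- far apart as acylindricity requires.
  obtain ⟨R, -, N, -, hN⟩ := hac (max (2 * (C + 3 * δ)) 1) (lt_max_of_lt_right one_pos)
  obtain ⟨M, hM⟩ := (tendsto_atTop.1 hf.tendsto R).exists
  refine hH.not_finite (Set.finite_coe_iff.2 ((Set.finite_of_encard_le_coe
    (hN (f ^ (I + 1) • o) (f ^ (I + M + 1) • o) ?_)).subset fun h hh =>
      ⟨(hmove h hh I le_rfl).trans (le_max_left _ _),
        (hmove h hh (I + M) (Nat.le_add_right _ _)).trans (le_max_left _ _)⟩))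
  rw [show I + M + 1 = I + 1 + M by ring, pow_add f (I + 1), mul_smul, dist_smul]
  exact hM

/-- Infinite recurrent subgroups of acylindrically hyperbolic groups are acylindrically
hyperbolic. -/
theorem IsAcylindricallyHyperbolic.of_recurrent
    (hG : IsAcylindricallyHyperbolic.{u, w} G) (H : Subgroup G)
    (hrec : ∀ h ∈ H, ∀ g : G, ∃ᶠ n : ℕ in atTop, g ^ n * h * (g ^ n)⁻¹ ∈ H)
    (hH : Infinite H) : IsAcylindricallyHyperbolic.{u, w} H := by
  obtain ⟨S, _, _, _, hS, hac, hne⟩ := hG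
  obtain ⟨δ, hδ⟩ := hS.exists_fourPoint
  refine ⟨S, inferInstance, inferInstance, ⟨fun h => isometry_smul S (h : G)⟩, hS, ?_,
    infinite_limitSet_of_recurrent hδ hac hne H hrec hH⟩
  intro ε hε
  obtain ⟨R, hR, N, hN, h⟩ := hac ε hε
  refine ⟨R, hR, N, hN, fun x y hxy => le_trans ?_ (h x y hxy)⟩
  rw [← Subtype.val_injective.encard_image]
  refine Set.encard_le_encard ?_
  rintro _ ⟨g, hg, rfl⟩
  exact hg

end Loxodromic

/-! ### Dietzmann's lemma and finite subgroups -/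

open scoped IsMulCommutative in
/-- **Dietzmann's lemma**, for a generating set. -/
theorem finite_of_closure_eq_top {N : Type u} [Group N] {T : Set N} (hT : T.Finite)
    (htop : Subgroup.closure T = ⊤) (hconj : ∀ n : N, ∀ t ∈ T, n * t * n⁻¹ ∈ T)
    (hord : ∀ t ∈ T, IsOfFinOrder t) : Finite N := by
  have := hT.to_subtype
  let act : MulAction N T :=
    { smul := fun n t => ⟨n * t * n⁻¹, hconj n t t.2⟩
      one_smul := fun t => Subtype.ext (by change 1 * (t : N) * 1⁻¹ = t; simp)
      mul_smul := fun m n t => Subtype.ext (by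
        change m * n * (t : N) * (m * n)⁻¹ = m * (n * t * n⁻¹) * m⁻¹; group) }
  -- An element acting trivially on T by conjugation centralizes a generating set; hence the centre
  -- has finite index.
  have hker : (MulAction.toPermHom N T).ker ≤ Subgroup.center N := by
    intro n hn
    rw [Subgroup.mem_center_iff]
    have hle : Subgroup.closure T ≤ Subgroup.centralizer {n} := by
      rw [Subgroup.closure_le]
      intro t ht
      have h1 : n * t * n⁻¹ = t :=
        congrArg Subtype.val (DFunLike.congr_fun (MonoidHom.mem_ker.1 hn) (⟨t, ht⟩ : T))
      rw [SetLike.mem_coe, Subgroup.mem_centralizer_singleton_iff]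
      exact (mul_inv_eq_iff_eq_mul.1 h1).symm
    intro g
    have hg : g ∈ Subgroup.centralizer {n} := hle (htop ▸ Subgroup.mem_top g)
    exact Subgroup.mem_centralizer_singleton_iff.1 hg
  have hfi : (Subgroup.center N).FiniteIndex := Subgroup.finiteIndex_of_le hker
  have hfg : Group.FG N := ⟨⟨hT.toFinset, by simpa using htop⟩⟩
  -- The transfer n ↦ n^[N:Z] into the centre is a homomorphism with torsion values on generators,
  -- so N is torsion; its centre is then finitely generated, abelian and torsion.
  have htors : IsMulTorsion N := by
    have hle : Subgroup.closure T ≤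
        (CommGroup.torsion (Subgroup.center N)).comap (MonoidHom.transferCenterPow N) := by
      rw [Subgroup.closure_le]
      intro t ht
      exact (MonoidHom.transferCenterPow N).isOfFinOrder (hord t ht)
    intro n
    have hn := hle (htop ▸ Subgroup.mem_top n)
    have h2 : IsOfFinOrder (MonoidHom.transferCenterPow N n) := hn
    have h3 := (Subgroup.center N).subtype.isOfFinOrder h2
    rw [Subgroup.coe_subtype, MonoidHom.transferCenterPow_apply] at h3
    exact h3.of_pow hfi.index_ne_zero
  have hZ : Finite (Subgroup.center N) :=
    CommGroup.finite_of_fg_isMulTorsion _ (htors.subgroup _)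
  exact Finite.of_subgroup_quotient (Subgroup.center N)

/-- **Dietzmann's lemma**. -/
theorem finite_closure {G : Type u} [Group G] {T : Set G} (hT : T.Finite)
    (hconj : ∀ g : G, ∀ t ∈ T, g * t * g⁻¹ ∈ T) (hord : ∀ t ∈ T, IsOfFinOrder t) :
    Finite (Subgroup.closure T) := by
  refine finite_of_closure_eq_top (T := ((↑) : Subgroup.closure T → G) ⁻¹' T)
    (hT.preimage Subtype.val_injective.injOn) Subgroup.closure_closure_coe_preimage
    (fun n t ht => hconj n t ht) fun t ht => ?_
  exact Submonoid.isOfFinOrder_coe.1 (hord _ ht)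

theorem normal_closure {G : Type u} [Group G] {T : Set G}
    (hconj : ∀ g : G, ∀ t ∈ T, g * t * g⁻¹ ∈ T) : (Subgroup.closure T).Normal := by
  refine ⟨fun n hn g => ?_⟩
  have h : Subgroup.closure T ≤ (Subgroup.closure T).comap (MulAut.conj g).toMonoidHom :=
    (Subgroup.closure_le _).2 fun t ht => Subgroup.subset_closure (hconj g t ht)
  exact h hn

theorem stabilizer_smul_eq_iff {G : Type u} [Group G] {X : Type v} [MulAction G X] (g : G) (x : X)
    (K : Subgroup G) :
    MulAction.stabilizer G (g • x) = K.map (MulAut.conj g).toMonoidHom ↔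
      MulAction.stabilizer G x = K := by
  rw [MulAction.stabilizer_smul_eq_stabilizer_map_conj]
  exact (Subgroup.map_injective (MulAut.conj g).injective).eq_iff

theorem countable_finite_subgroups (G : Type u) [Group G] [Countable G] :
    {K : Subgroup G | Finite K}.Countable := by
  refine Set.MapsTo.countable_of_injOn (f := fun K : Subgroup G => (K : Set G))
    (t := {s : Set G | s.Finite ∧ s ⊆ Set.univ})
    (fun K hK => ⟨Set.finite_coe_iff.1 hK, Set.subset_univ _⟩) SetLike.coe_injective.injOn
    (Set.countable_ofPred_finite_subset Set.countable_univ)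

/-! ### Measurability and recurrence of stabilizers -/

section Stabilizers

variable {G : Type u} [Group G] {X : Type v} [MeasurableSpace X] [StandardBorelSpace X]
  [MulAction G X] [MeasurableConstSMul G X]

theorem measurableSet_fixed (g : G) : MeasurableSet {x : X | g • x = x} :=
  measurableSet_eq_fun (measurable_const_smul g) measurable_id

variable [Countable G]

theorem measurableSet_stabilizer_eq (K : Subgroup G) :
    MeasurableSet {x : X | MulAction.stabilizer G x = K} := by
  have : {x : X | MulAction.stabilizer G x = K} =
      ⋂ g : G, {x | g • x = x ↔ g ∈ K} := by
    ext x
    simp [Subgroup.ext_iff, MulAction.mem_stabilizer_iff]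
  rw [this]
  refine MeasurableSet.iInter fun g => ?_
  by_cases hg : g ∈ K
  · simp only [hg, iff_true]
    exact measurableSet_fixed g
  · simp only [hg, iff_false]
    exact (measurableSet_fixed g).compl

theorem measurableSet_finite_stabilizer :
    MeasurableSet {x : X | Finite (MulAction.stabilizer G x)} := by
  have : {x : X | Finite (MulAction.stabilizer G x)} =
      ⋃ K ∈ {K : Subgroup G | Finite K}, {x : X | MulAction.stabilizer G x = K} := by
    ext x; simp
  rw [this]
  exact MeasurableSet.biUnion (countable_finite_subgroups G)
    fun K _ => measurableSet_stabilizer_eq K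

/-- Poincaré recurrence for g⁻¹ on the fixed set of h: g^(-n) x is fixed by h exactly when g^n h
g^(-n) fixes x. Countability of G merges the null sets. -/
theorem ae_recurrent_stabilizer (ν : Measure X) [IsFiniteMeasure ν]
    [SMulInvariantMeasure G X ν] :
    ∀ᵐ x ∂ν, ∀ h ∈ MulAction.stabilizer G x, ∀ g : G, ∃ᶠ n : ℕ in atTop,
      g ^ n * h * (g ^ n)⁻¹ ∈ MulAction.stabilizer G x := by
  have key : ∀ h g : G, ∀ᵐ x ∂ν, h • x = x → ∃ᶠ n : ℕ in atTop,
      g ^ n * h * (g ^ n)⁻¹ ∈ MulAction.stabilizer G x := by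
    intro h g
    have hcons := (measurePreserving_smul g⁻¹ ν).conservative
    filter_upwards [hcons.ae_mem_imp_frequently_image_mem
      (measurableSet_fixed h).nullMeasurableSet] with x hx hfix
    refine (hx hfix).mono fun n hn => ?_
    rw [smul_iterate, inv_pow] at hn
    change h • (g ^ n)⁻¹ • x = (g ^ n)⁻¹ • x at hn
    rw [MulAction.mem_stabilizer_iff, mul_smul, mul_smul, hn, smul_inv_smul]
  filter_upwards [ae_all_iff.2 fun h => ae_all_iff.2 (key h)] with x hx h hh g
  exact hx h g hh

/-- A finite subgroup that is a stabilizer with positive probability lies in a finite normal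
subgroup. -/
theorem le_finiteRadical_of_measure_ne_zero (ν : Measure X) [IsFiniteMeasure ν]
    [SMulInvariantMeasure G X ν] (F : Subgroup G) (hF : Finite F)
    (hν : ν {x : X | MulAction.stabilizer G x = F} ≠ 0) : F ≤ finiteRadical G := by
  let A : Subgroup G → Set X := fun K => {x | MulAction.stabilizer G x = K}
  -- The level sets of the stabilizer map are disjoint, so only finitely many have measure at least
  -- that of F; invariance of ν makes this family closed under conjugation.
  let 𝒦 : Set (Subgroup G) := {K | ν (A F) ≤ ν (A K) ∧ Finite K}
  have h𝒦 : 𝒦.Finite := by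
    refine (Measure.finite_const_le_meas_of_disjoint_iUnion ν (pos_iff_ne_zero.2 hν)
      measurableSet_stabilizer_eq ?_ (measure_ne_top _ _)).subset fun K hK => hK.1
    intro K L hKL
    exact Set.disjoint_left.2 fun x hx hx' => hKL (hx.symm.trans hx')
  let T : Set G := ⋃ K ∈ 𝒦, (K : Set G)
  have hT : T.Finite := h𝒦.biUnion fun K hK => Set.finite_coe_iff.1 hK.2
  have hconj : ∀ g : G, ∀ t ∈ T, g * t * g⁻¹ ∈ T := by
    intro g t ht
    obtain ⟨K, ⟨hK, hfin⟩, htK⟩ := Set.mem_iUnion₂.1 ht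
    refine Set.mem_iUnion₂.2 ⟨K.map (MulAut.conj g).toMonoidHom, ⟨?_, ?_⟩, t, htK, rfl⟩
    · refine hK.trans_eq ?_
      rw [← measure_preimage_smul ν g (A (K.map _))]
      congr 1
      ext x
      exact (stabilizer_smul_eq_iff g x K).symm
    · exact Set.finite_coe_iff.2 ((Set.finite_coe_iff.1 hfin).image _)
  have hord : ∀ t ∈ T, IsOfFinOrder t := by
    intro t ht
    obtain ⟨K, ⟨-, hfin⟩, htK⟩ := Set.mem_iUnion₂.1 ht
    exact K.subtype.isOfFinOrder (isOfFinOrder_of_finite (⟨t, htK⟩ : K))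
  have hle : F ≤ Subgroup.closure T := fun t ht =>
    Subgroup.subset_closure (Set.mem_iUnion₂.2 ⟨F, ⟨le_rfl, hF⟩, ht⟩)
  exact hle.trans (le_sSup ⟨normal_closure hconj, finite_closure hT hconj hord⟩)

end Stabilizers

end AcylHyp

theorem mainTheorem5 (G : Type u) [Group G] [Countable G]
    (hG : AcylHyp.IsAcylindricallyHyperbolic.{u, w} G)
    (X : Type v) [MeasurableSpace X] [StandardBorelSpace X]
    (ν : Measure X) [IsProbabilityMeasure ν]
    [MulAction G X] [MeasurableConstSMul G X] [ErgodicSMul G X ν] :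
    ((∀ᵐ x ∂ν, AcylHyp.IsAcylindricallyHyperbolic.{u, w} (MulAction.stabilizer G x)) ∨
      (∀ᵐ x ∂ν, Finite (MulAction.stabilizer G x))) ∧
    (AcylHyp.finiteRadical G = ⊥ →
      (∀ᵐ x ∂ν, Finite (MulAction.stabilizer G x)) →
        AcylHyp.IsEssentiallyFree G ν) := by
  constructor
  · have hconst := aeconst_of_forall_preimage_smul_ae_eq G (μ := ν)
      (AcylHyp.measurableSet_finite_stabilizer (G := G) (X := X)).nullMeasurableSet
      (fun g => Filter.EventuallyEq.of_eq (by
        refine Set.ext fun x => ?_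
        change Finite (MulAction.stabilizer G (g • x)) ↔ Finite (MulAction.stabilizer G x)
        rw [MulAction.stabilizer_smul_eq_stabilizer_map_conj]
        exact ((MulAction.stabilizer G x).equivMapOfInjective _
          (MulAut.conj g).injective).toEquiv.finite_iff.symm))
    rcases eventuallyConst_set.1 hconst with h | h
    · exact Or.inr h
    · left
      filter_upwards [h, AcylHyp.ae_recurrent_stabilizer (G := G) ν] with x hx hrec
      exact hG.of_recurrent _ hrec (not_finite_iff_infinite.1 hx)
  · intro hrad hfin
    -- There are only countably many finite subgroups, so each nontrivial one can be excluded
    -- separately.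
    have hnull : ∀ᵐ x ∂ν, ∀ F ∈ {K : Subgroup G | Finite K}, F ≠ ⊥ →
        MulAction.stabilizer G x ≠ F := by
      refine (ae_ball_iff (AcylHyp.countable_finite_subgroups G)).2 fun F hF => ?_
      by_cases hbot : F = ⊥
      · exact .of_forall fun x h => (h hbot).elim
      · have h0 : ν {x : X | MulAction.stabilizer G x = F} = 0 := by
          by_contra hν
          exact hbot (le_bot_iff.1
            (hrad ▸ AcylHyp.le_finiteRadical_of_measure_ne_zero ν F hF hν))
        filter_upwards [measure_eq_zero_iff_ae_notMem.1 h0] with x hx _ using hx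
    filter_upwards [hfin, hnull] with x hx hx'
    by_contra hbot
    exact hx' _ hx hbot rfl
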